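/- All graphs are finite, simple and undirected. For a graph $G$ let $\delta(G)$ and $\Delta(G)$ denote its minimum and maximum degree; the order of $G$ is $|V(G)|$. A graph is traceable if it contains a spanning path, and a Hamiltonian cycle is a spanning cycle. The Cartesian product $G_1\square G_2$ has vertex set $V(G_1)\times V(G_2)$, where $(v,u)$ and $(v',u')$ are adjacent if and only if either $v=v'$ and $uu'\in E(G_2)$, or $u=u'$ and $vv'\in E(G_1)$. Let $G_2$ be a connected graph with $\delta(G_2)\geq |V(G_2)|/3$, and let $G_1$ be a traceable graph of even order. If $|V(G_1)|\geq 4\Delta(G_2)-2$, then $G_1\square G_2$ has a Hamiltonian cycle. -/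

import Mathlib

/-- A graph is traceable if it contains a spanning path, i.e. a path that visits every vertex
(exactly once). -/
def SimpleGraph.IsTraceable {V : Type*} [DecidableEq V] (G : SimpleGraph V) : Prop :=
  ∃ (a b : V) (p : G.Walk a b), p.IsHamiltonian

/-! Order the rows of the product along the spanning path of `G₁`, giving `2 * (k + 1)` of them.
Since `δ(G₂)` is at least a third of the order, a maximum matching of `G₂` leaves at most `δ(G₂)`
vertices unmatched, and these can be hung on distinct matching edges. So `G₂` splits into blocks
that are paths on two or three vertices (`exists_partition_paths`).

Over one block, cycles on row pairs are stacked into a spanning cycle that uses many rungs, the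
edges joining consecutive pairs. If two disjoint cycles use rung `t` over adjacent vertices `u` and
`w`, exchanging these two rungs for the two copies of `uw` merges the cycles. Connectivity then lets
the blocks be attached one by one, provided every vertex keeps at least as many rungs as it has
neighbours not yet reached (`exists_hasRungCycle_univ`).

A vertex has a neighbour in its own block, so `Δ - 1` rungs suffice. The ends of a three-vertex
block share the `k` levels, so `k ≥ 2 * (Δ - 1)` is needed, which is `|V₁| ≥ 4 * Δ - 2`. -/

namespace SimpleGraph

/-! ### Cycles through prescribed edges and their merging -/

/-- `G` has a cycle whose vertex set is `S` and which traverses every edge in `E`. -/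
def HasCycleOn {V : Type*} (G : SimpleGraph V) (S : Set V) (E : Set (Sym2 V)) : Prop :=
  ∃ (x : V) (c : G.Walk x x), c.IsCycle ∧ (∀ v, v ∈ c.support ↔ v ∈ S) ∧ ∀ e ∈ E, e ∈ c.edges

theorem HasCycleOn.mono {V : Type*} {G : SimpleGraph V} {S T : Set V} {E F : Set (Sym2 V)}
    (h : G.HasCycleOn S E) (hS : ∀ v, v ∈ S ↔ v ∈ T) (hF : F ⊆ E) : G.HasCycleOn T F := by
  obtain ⟨x, c, hc, hs, he⟩ := h
  exact ⟨x, c, hc, fun v => (hs v).trans (hS v), fun e h' => he e (hF h')⟩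

/-- Deleting an edge of a cycle leaves a path. -/
theorem Walk.IsCycle.exists_isPath_of_mem_edges {V : Type*} {G : SimpleGraph V} {x a a' : V}
    {c : G.Walk x x} (hc : c.IsCycle) (h : s(a, a') ∈ c.edges) :
    ∃ p : G.Walk a' a, p.IsPath ∧ (∀ v, v ∈ p.support ↔ v ∈ c.support) ∧
      ∀ e ∈ c.edges, e = s(a, a') ∨ e ∈ p.edges := by
  classical
  have ha : a ∈ c.support := c.fst_mem_support_of_mem_edges h
  have hd : (c.rotate a ha).IsCycle := (Walk.isCycle_rotate ha).2 hc
  have hsup : ∀ v, v ∈ (c.rotate a ha).support ↔ v ∈ c.support := fun v => by simp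
  have hedg : ∀ e, e ∈ (c.rotate a ha).edges ↔ e ∈ c.edges :=
    fun e => (c.rotate_edges a ha).mem_iff
  generalize c.rotate a ha = d at hd hsup hedg
  rw [← hedg] at h
  simp only [← hsup, ← hedg]
  clear hsup hedg ha hc
  have key : ∀ d : G.Walk a a, d.IsCycle → d.snd = a' → ∃ p : G.Walk a' a, p.IsPath ∧
      (∀ v, v ∈ p.support ↔ v ∈ d.support) ∧ ∀ e ∈ d.edges, e = s(a, a') ∨ e ∈ p.edges := by
    intro d hd hs
    cases d with
    | nil => exact absurd hd (by simp)
    | cons hadj p =>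
      rw [Walk.snd_cons] at hs
      subst hs
      refine ⟨p, ((Walk.cons_isCycle_iff p hadj).1 hd).1, fun v => ?_, fun e he => ?_⟩
      · simp only [Walk.support_cons, List.mem_cons]
        constructor
        · exact Or.inr
        · rintro (rfl | hv)
          · exact p.end_mem_support
          · exact hv
      · simpa using he
  by_cases hs : d.snd = a'
  · exact key d hd hs
  -- The edge is the first or the last one of the cycle based at `a`; reversal reduces the latter
  -- case to the former.
  · have hp : d.penultimate = a' := by
      cases d with
      | nil => exact absurd hd (by simp)
      | cons hadj p =>
        rw [Walk.snd_cons] at hs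
        obtain ⟨hp, hn⟩ := (Walk.cons_isCycle_iff p hadj).1 hd
        have hne : ¬ p.Nil := Walk.not_nil_of_ne hadj.ne'
        rw [Walk.penultimate_cons_of_not_nil _ _ hne]
        rw [Walk.edges_cons, List.mem_cons] at h
        rcases h with h | h
        · exact absurd (Sym2.congr_right.1 h).symm hs
        · exact (hp.eq_penultimate_of_mem_edges h).symm
    have := key d.reverse hd.reverse (by rw [Walk.snd_reverse, hp])
    simpa using this

/-- Two disjoint cycles can be merged along parallel edges `s(a, a')` and `s(b, b')`. -/
theorem HasCycleOn.merge {V : Type*} {G : SimpleGraph V} {S T : Set V} {E F : Set (Sym2 V)}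
    (hS : G.HasCycleOn S E) (hT : G.HasCycleOn T F) (hdis : ∀ v ∈ S, v ∉ T) {a a' b b' : V}
    (ha : s(a, a') ∈ E) (hb : s(b, b') ∈ F) (hab : G.Adj a b) (hab' : G.Adj a' b') :
    G.HasCycleOn (S ∪ T) ({s(a, b), s(a', b')} ∪ E \ {s(a, a')} ∪ F \ {s(b, b')}) := by
  obtain ⟨x, c, hc, hcs, hce⟩ := hS
  obtain ⟨y, d, hd, hds, hde⟩ := hT
  obtain ⟨p, hp, hps, hpe⟩ := hc.exists_isPath_of_mem_edges (hce _ ha)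
  obtain ⟨q, hq, hqs, hqe⟩ := hd.exists_isPath_of_mem_edges (Sym2.eq_swap ▸ hde _ hb)
  simp only [hcs, hds] at hps hqs
  have hne : a ≠ a' := (c.adj_of_mem_edges (hce _ ha)).ne
  have haS : a ∈ S := (hps a).1 p.end_mem_support
  have haS' : a' ∈ S := (hps a').1 p.start_mem_support
  have hbT : b ∈ T := (hqs b).1 q.start_mem_support
  have hbT' : b' ∈ T := (hqs b').1 q.end_mem_support
  have hpath : (p.append (Walk.cons hab q)).IsPath := by
    rw [Walk.isPath_def, Walk.support_append, Walk.support_cons, List.tail_cons,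
      List.nodup_append']
    exact ⟨hp.support_nodup, hq.support_nodup,
      fun v hv hv' => hdis v ((hps v).1 hv) ((hqs v).1 hv')⟩
  refine ⟨b', Walk.cons hab'.symm (p.append (Walk.cons hab q)), ?_, ?_, ?_⟩
  · rw [Walk.cons_isCycle_iff]
    refine ⟨hpath, ?_⟩
    rw [Walk.edges_append, Walk.edges_cons, List.mem_append, List.mem_cons]
    rintro (h | h | h)
    · exact hdis b' ((hps _).1 (p.fst_mem_support_of_mem_edges h)) hbT'
    · rcases Sym2.eq_iff.1 h with ⟨h1, h2⟩ | ⟨h1, h2⟩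
      · exact hdis a haS (h1 ▸ hbT')
      · exact hne h2.symm
    · exact hdis a' haS' ((hqs _).1 (q.snd_mem_support_of_mem_edges h))
  · intro v
    rw [Walk.support_cons, List.mem_cons, Walk.mem_support_append_iff, Walk.support_cons,
      List.mem_cons, hps, hqs, Set.mem_union]
    constructor
    · rintro (rfl | h | rfl | h) <;> tauto
    · tauto
  · intro e he
    rw [Walk.edges_cons, List.mem_cons, Walk.edges_append, List.mem_append, Walk.edges_cons,
      List.mem_cons]
    rcases he with ((rfl | he) | ⟨he, hne⟩) | ⟨he, hne⟩
    · tauto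
    · rw [Set.mem_singleton_iff] at he
      rw [he, Sym2.eq_swap]
      tauto
    · have := hpe e (hce e he)
      rw [Set.mem_singleton_iff] at hne
      tauto
    · have := hqe e (hde e he)
      rw [Set.mem_singleton_iff, Sym2.eq_swap] at hne
      tauto

/-! ### Stacking cycles over a small block -/

variable {V₁ V₂ : Type*} {G₁ : SimpleGraph V₁} {G₂ : SimpleGraph V₂}

/-- Cycles on consecutive pairs of rows can be stacked, joining pair number `i` to the next one
along the columns `x i` and `y i`, where `s(x i, y i)` is an edge that the cycles use on every row. -/
theorem hasCycleOn_rows {r : ℕ → V₁} {k : ℕ}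
    (hinj : ∀ i < 2 * k, ∀ j < 2 * k, r i = r j → i = j)
    (hadj : ∀ i, i + 1 < 2 * k → G₁.Adj (r i) (r (i + 1))) {B : Set V₂} {D : Set (Sym2 V₂)}
    (hblock : ∀ j < k, (G₁ □ G₂).HasCycleOn {v | (v.1 = r (2 * j) ∨ v.1 = r (2 * j + 1)) ∧ v.2 ∈ B}
      {e | ∃ x y, s(x, y) ∈ D ∧ (e = s((r (2 * j), x), (r (2 * j), y)) ∨
        e = s((r (2 * j + 1), x), (r (2 * j + 1), y)))})
    (x y : ℕ → V₂) (hD : ∀ i, s(x i, y i) ∈ D) (m : ℕ) (hm : m < k) :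
    (G₁ □ G₂).HasCycleOn {v | (∃ i < 2 * m + 2, v.1 = r i) ∧ v.2 ∈ B}
      ({e | ∃ x y, s(x, y) ∈ D ∧ e = s((r (2 * m + 1), x), (r (2 * m + 1), y))} ∪
       {e | ∃ i < m, ∃ z, (z = x i ∨ z = y i) ∧
        e = s((r (2 * i + 1), z), (r (2 * i + 2), z))}) := by
  induction m with
  | zero =>
    refine (hblock 0 hm).mono (fun v => ?_) ?_
    · simp only [Set.mem_ofPred_eq]
      refine and_congr_left fun _ => ⟨?_, ?_⟩
      · rintro (h | h)
        · exact ⟨0, by omega, h⟩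
        · exact ⟨1, by omega, h⟩
      · rintro ⟨i, hi, h⟩
        have : i = 0 ∨ i = 1 := by omega
        rcases this with rfl | rfl
        · exact Or.inl h
        · exact Or.inr h
    · rintro e (⟨x, y, hxy, rfl⟩ | ⟨i, hi, -⟩)
      · exact ⟨x, y, hxy, Or.inr rfl⟩
      · omega
  | succ m ih =>
    have hne : r (2 * m + 1) ≠ r (2 * m + 2) := (hadj (2 * m + 1) (by omega)).ne
    refine ((ih (by omega)).merge (hblock (m + 1) hm) ?_
      (a := (r (2 * m + 1), x m)) (a' := (r (2 * m + 1), y m))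
      (b := (r (2 * m + 2), x m)) (b' := (r (2 * m + 2), y m)) ?_ ?_ ?_ ?_).mono (fun v => ?_) ?_
    · rintro v ⟨⟨i, hi, h⟩, -⟩ ⟨h' | h', -⟩
      · have := hinj _ (by omega) _ (by omega) (h.symm.trans h'); omega
      · have := hinj _ (by omega) _ (by omega) (h.symm.trans h'); omega
    · exact Or.inl ⟨_, _, hD m, rfl⟩
    · exact ⟨_, _, hD m, Or.inl rfl⟩
    · exact boxProd_adj.2 (Or.inl ⟨hadj (2 * m + 1) (by omega), rfl⟩)
    · exact boxProd_adj.2 (Or.inl ⟨hadj (2 * m + 1) (by omega), rfl⟩)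
    · simp only [Set.mem_union, Set.mem_ofPred_eq]
      rw [← or_and_right]
      refine and_congr_left fun _ => ⟨?_, ?_⟩
      · rintro (⟨i, hi, h⟩ | h | h)
        · exact ⟨i, by omega, h⟩
        · exact ⟨_, by omega, h⟩
        · exact ⟨_, by omega, h⟩
      · rintro ⟨i, hi, h⟩
        have : i < 2 * m + 2 ∨ i = 2 * (m + 1) ∨ i = 2 * (m + 1) + 1 := by omega
        rcases this with hi | rfl | rfl
        · exact Or.inl ⟨i, hi, h⟩
        · exact Or.inr (Or.inl h)
        · exact Or.inr (Or.inr h)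
    · rintro e (⟨u, v, huv, rfl⟩ | ⟨i, hi, z, hz, rfl⟩)
      -- The merge deletes an edge of the lower row of the new pair; its upper row stays intact for
      -- the next merge.
      · refine Or.inr ⟨⟨u, v, huv, Or.inr rfl⟩, fun h => ?_⟩
        have : r (2 * (m + 1) + 1) = r (2 * m + 2) := by
          rcases Sym2.eq_iff.1 h with ⟨h, -⟩ | ⟨h, -⟩ <;> exact congrArg Prod.fst h
        have := hinj _ (by omega) _ (by omega) this
        omega
      · rcases Nat.lt_succ_iff_lt_or_eq.1 hi with hi | rfl
        · refine Or.inl (Or.inr ⟨Or.inr ⟨i, hi, z, hz, rfl⟩, fun h => ?_⟩)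
          have h1 : r (2 * i + 1) ≠ r (2 * i + 2) := (hadj (2 * i + 1) (by omega)).ne
          refine h1 ?_
          rcases Sym2.eq_iff.1 h with ⟨h, h'⟩ | ⟨h, h'⟩ <;>
            exact (congrArg Prod.fst h).trans (congrArg Prod.fst h').symm
        · refine Or.inl (Or.inl ?_)
          rcases hz with rfl | rfl
          · exact Or.inl rfl
          · exact Or.inr rfl

/-- The ladder with two rungs. -/
theorem hasCycleOn_block_two {p q : V₁} (hpq : G₁.Adj p q) {a b : V₂} (hab : G₂.Adj a b) :
    (G₁ □ G₂).HasCycleOn {v | (v.1 = p ∨ v.1 = q) ∧ v.2 ∈ ({a, b} : Set V₂)}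
      {e | ∃ x y, s(x, y) ∈ ({s(a, b)} : Set (Sym2 V₂)) ∧
        (e = s((p, x), (p, y)) ∨ e = s((q, x), (q, y)))} := by
  have h1 : (G₁ □ G₂).Adj (p, a) (p, b) := boxProd_adj.2 (Or.inr ⟨hab, rfl⟩)
  have h2 : (G₁ □ G₂).Adj (p, b) (q, b) := boxProd_adj.2 (Or.inl ⟨hpq, rfl⟩)
  have h3 : (G₁ □ G₂).Adj (q, b) (q, a) := boxProd_adj.2 (Or.inr ⟨hab.symm, rfl⟩)
  have h4 : (G₁ □ G₂).Adj (q, a) (p, a) := boxProd_adj.2 (Or.inl ⟨hpq.symm, rfl⟩)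
  have n1 := hpq.ne
  have n2 := hab.ne
  refine ⟨_, .cons h1 (.cons h2 (.cons h3 (.cons h4 .nil))), ?_, ?_, ?_⟩
  · rw [Walk.cons_isCycle_iff]
    simp [Walk.isPath_def, n1, n2, n1.symm, n2.symm]
  · rintro ⟨u, v⟩
    simp only [Walk.support_cons, Walk.support_nil, List.mem_cons, Prod.mk.injEq, Set.mem_ofPred_eq,
      Set.mem_insert_iff, Set.mem_singleton_iff, List.not_mem_nil]
    tauto
  · rintro e ⟨x, y, hxy, he⟩
    simp only [Set.mem_singleton_iff, Sym2.eq_iff] at hxy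
    simp only [Walk.edges_cons, Walk.edges_nil, List.mem_cons]
    rcases hxy with ⟨rfl, rfl⟩ | ⟨rfl, rfl⟩ <;> rcases he with rfl | rfl <;> simp

/-- The `2 × 3` grid. -/
theorem hasCycleOn_block_three {p q : V₁} (hpq : G₁.Adj p q) {a b c : V₂} (hab : G₂.Adj a b)
    (hbc : G₂.Adj b c) (hac : a ≠ c) :
    (G₁ □ G₂).HasCycleOn {v | (v.1 = p ∨ v.1 = q) ∧ v.2 ∈ ({a, b, c} : Set V₂)}
      {e | ∃ x y, s(x, y) ∈ ({s(a, b), s(c, b)} : Set (Sym2 V₂)) ∧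
        (e = s((p, x), (p, y)) ∨ e = s((q, x), (q, y)))} := by
  have h1 : (G₁ □ G₂).Adj (p, a) (p, b) := boxProd_adj.2 (Or.inr ⟨hab, rfl⟩)
  have h2 : (G₁ □ G₂).Adj (p, b) (p, c) := boxProd_adj.2 (Or.inr ⟨hbc, rfl⟩)
  have h3 : (G₁ □ G₂).Adj (p, c) (q, c) := boxProd_adj.2 (Or.inl ⟨hpq, rfl⟩)
  have h4 : (G₁ □ G₂).Adj (q, c) (q, b) := boxProd_adj.2 (Or.inr ⟨hbc.symm, rfl⟩)
  have h5 : (G₁ □ G₂).Adj (q, b) (q, a) := boxProd_adj.2 (Or.inr ⟨hab.symm, rfl⟩)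
  have h6 : (G₁ □ G₂).Adj (q, a) (p, a) := boxProd_adj.2 (Or.inl ⟨hpq.symm, rfl⟩)
  have n1 := hpq.ne
  have n2 := hab.ne
  have n3 := hbc.ne
  refine ⟨_, .cons h1 (.cons h2 (.cons h3 (.cons h4 (.cons h5 (.cons h6 .nil))))), ?_, ?_, ?_⟩
  · rw [Walk.cons_isCycle_iff]
    simp [Walk.isPath_def, n1, n2, n3, hac, n1.symm, n2.symm, n3.symm, hac.symm]
  · rintro ⟨u, v⟩
    simp only [Walk.support_cons, Walk.support_nil, List.mem_cons, Prod.mk.injEq, Set.mem_ofPred_eq,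
      Set.mem_insert_iff, Set.mem_singleton_iff, List.not_mem_nil]
    tauto
  · rintro e ⟨x, y, hxy, he⟩
    simp only [Set.mem_insert_iff, Set.mem_singleton_iff, Sym2.eq_iff] at hxy
    simp only [Walk.edges_cons, Walk.edges_nil, List.mem_cons]
    rcases hxy with (⟨rfl, rfl⟩ | ⟨rfl, rfl⟩) | (⟨rfl, rfl⟩ | ⟨rfl, rfl⟩) <;>
      rcases he with rfl | rfl <;> simp

/-! ### Rungs and attachable blocks -/

/-- The edge over `v` that joins rows `2 * i + 1` and `2 * i + 2`. -/
def rung (r : ℕ → V₁) (v : V₂) (i : ℕ) : Sym2 (V₁ × V₂) :=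
  s((r (2 * i + 1), v), (r (2 * i + 2), v))

/-- The product of `G₁` and `B` has a spanning cycle that uses the rungs prescribed by `A`. -/
def HasRungCycle (G₁ : SimpleGraph V₁) (G₂ : SimpleGraph V₂) (r : ℕ → V₁) (B : Set V₂)
    (A : V₂ → Finset ℕ) : Prop :=
  (G₁ □ G₂).HasCycleOn {v | v.2 ∈ B} {e | ∃ v ∈ B, ∃ i ∈ A v, e = rung r v i}

/-- `B` can be attached along any rung of any of its vertices, and then every vertex of `B` still
has `d` rungs, counting the one used. -/
def IsAttachable (G₁ : SimpleGraph V₁) (G₂ : SimpleGraph V₂) (r : ℕ → V₁) (K d : ℕ)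
    (B : Set V₂) : Prop :=
  ∀ w ∈ B, ∀ t, ∃ A : V₂ → Finset ℕ, (t < K → t ∈ A w) ∧
    (∀ v ∈ B, A v ⊆ Finset.range K ∧ d ≤ (A v).card) ∧ HasRungCycle G₁ G₂ r B A

/-- Every level must be crossed along both columns, so all `k` rungs over both vertices are present,
whatever `t` is. -/
theorem isAttachable_pair {r : ℕ → V₁} {k d : ℕ}
    (hinj : ∀ i < 2 * (k + 1), ∀ j < 2 * (k + 1), r i = r j → i = j)
    (hadj : ∀ i, i + 1 < 2 * (k + 1) → G₁.Adj (r i) (r (i + 1)))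
    (hsurj : ∀ v, ∃ i < 2 * (k + 1), r i = v) (hd : d ≤ k) {a b : V₂} (hab : G₂.Adj a b) :
    IsAttachable G₁ G₂ r k d {a, b} := by
  intro w hw t
  refine ⟨fun _ => Finset.range k, Finset.mem_range.2, fun v hv => ⟨subset_rfl, by simpa⟩, ?_⟩
  refine (hasCycleOn_rows hinj hadj
    (fun j hj => hasCycleOn_block_two (hadj (2 * j) (by omega)) hab)
    (fun _ => a) (fun _ => b) (fun _ => rfl) k (by omega)).mono (fun v => ?_) ?_
  · obtain ⟨i, hi, h⟩ := hsurj v.1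
    exact ⟨fun h => h.2, fun h' => ⟨⟨i, hi, h.symm⟩, h'⟩⟩
  · rintro e ⟨v, hv, i, hi, rfl⟩
    exact Or.inr ⟨i, Finset.mem_range.1 hi, v, hv, rfl⟩

/-- Each level is crossed over the middle vertex and one freely chosen end. The middle thus gets all
`k` rungs, and the ends split them into two parts of size at least `d`. -/
theorem isAttachable_triple {r : ℕ → V₁} {k d : ℕ}
    (hinj : ∀ i < 2 * (k + 1), ∀ j < 2 * (k + 1), r i = r j → i = j)
    (hadj : ∀ i, i + 1 < 2 * (k + 1) → G₁.Adj (r i) (r (i + 1)))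
    (hsurj : ∀ v, ∃ i < 2 * (k + 1), r i = v) (hd : 2 * d ≤ k) (hd1 : 1 ≤ d) {a b c : V₂}
    (hab : G₂.Adj a b) (hbc : G₂.Adj b c) (hac : a ≠ c) :
    IsAttachable G₁ G₂ r k d {a, b, c} := by
  classical
  have key : ∀ t < k, ∀ a c, G₂.Adj a b → G₂.Adj b c → a ≠ c → ∃ A : V₂ → Finset ℕ,
      t ∈ A a ∧ t ∈ A b ∧ (∀ v ∈ ({a, b, c} : Set V₂), A v ⊆ Finset.range k ∧ d ≤ (A v).card) ∧
      HasRungCycle G₁ G₂ r {a, b, c} A := by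
    intro t ht a c hab hbc hac
    -- `T` is the set of levels crossed over `a`; the others are crossed over `c`.
    obtain ⟨T, htT, hT, hTc⟩ := Finset.exists_subsuperset_card_eq (n := d)
      (Finset.singleton_subset_iff.2 (Finset.mem_range.2 ht)) (by simpa) (by simp; omega)
    have hcc : d ≤ (Finset.range k \ T).card := by
      rw [Finset.card_sdiff_of_subset hT, Finset.card_range]; omega
    refine ⟨fun v => if v = a then T else if v = b then Finset.range k else Finset.range k \ T,
      ?_, ?_, ?_, ?_⟩
    · simpa using htT
    · simp [hab.ne', ht]
    · rintro v (rfl | rfl | rfl)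
      · simp [hT, hTc]
      · beta_reduce
        rw [if_neg hab.ne', if_pos rfl, Finset.card_range]
        exact ⟨subset_rfl, by omega⟩
      · beta_reduce
        rw [if_neg hac.symm, if_neg hbc.ne']
        exact ⟨Finset.sdiff_subset, hcc⟩
    · refine (hasCycleOn_rows hinj hadj
        (fun j hj => hasCycleOn_block_three (hadj (2 * j) (by omega)) hab hbc hac)
        (fun i => if i ∈ T then a else c) (fun _ => b)
        (fun i => by by_cases h : i ∈ T <;> simp [h]) k (by omega)).mono (fun v => ?_) ?_
      · obtain ⟨i, hi, h⟩ := hsurj v.1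
        exact ⟨fun h => h.2, fun h' => ⟨⟨i, hi, h.symm⟩, h'⟩⟩
      · rintro e ⟨v, hv, i, hi, rfl⟩
        beta_reduce at hi
        rcases hv with rfl | rfl | rfl
        · rw [if_pos rfl] at hi
          exact Or.inr ⟨i, Finset.mem_range.1 (hT hi), v, by simp [hi], rfl⟩
        · rw [if_neg hab.ne', if_pos rfl] at hi
          exact Or.inr ⟨i, Finset.mem_range.1 hi, v, by simp, rfl⟩
        · rw [if_neg hac.symm, if_neg hbc.ne', Finset.mem_sdiff] at hi
          exact Or.inr ⟨i, Finset.mem_range.1 hi.1, v, by simp [hi.2], rfl⟩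
  rintro w (rfl | rfl | rfl) t
  -- If `t ≥ k` nothing is required of `t`, and level `0` serves as a default.
  all_goals obtain ⟨t', ht', h⟩ : ∃ t' < k, t < k → t = t' :=
    if h : t < k then ⟨t, h, fun _ => rfl⟩ else ⟨0, by omega, fun h' => absurd h' h⟩
  · obtain ⟨A, h1, h2, h3⟩ := key t' ht' w c hab hbc hac
    exact ⟨A, fun ht => h ht ▸ h1, h3⟩
  · obtain ⟨A, h1, h2, h3⟩ := key t' ht' a c hab hbc hac
    exact ⟨A, fun ht => h ht ▸ h2, h3⟩
  · obtain ⟨A, h1, h2, h3⟩ := key t' ht' w a hbc.symm hab.symm hac.symm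
    rw [show ({a, b, w} : Set V₂) = {w, b, a} by ext; simp; tauto]
    exact ⟨A, fun ht => h ht ▸ h1, h3⟩

/-! ### Matchings and the partition into short paths -/

/-- The matchings of `G`, as involutions, have a member with the fewest unmatched vertices; it
admits no augmenting path of length one or three. -/
theorem exists_matching_without_augmentation {V : Type*} [Fintype V] [DecidableEq V]
    (G : SimpleGraph V) : ∃ σ : V → V, (∀ v, σ (σ v) = v) ∧ (∀ v, σ v ≠ v → G.Adj v (σ v)) ∧
      (∀ u u', σ u = u → σ u' = u' → ¬ G.Adj u u') ∧
      ∀ u u' x, σ u = u → σ u' = u' → u ≠ u' → G.Adj u x → ¬ G.Adj u' (σ x) := by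
  obtain ⟨σ, ⟨hσ, hadj⟩, hmin⟩ := Set.exists_min_image
    {σ : V → V | (∀ v, σ (σ v) = v) ∧ ∀ v, σ v ≠ v → G.Adj v (σ v)}
    (fun σ => (Finset.univ.filter fun v => σ v = v).card) (Set.toFinite _)
    ⟨id, fun _ => rfl, fun v h => absurd rfl h⟩
  have aug : ∀ τ : V → V, (∀ v, τ (τ v) = v) → (∀ v, τ v ≠ v → G.Adj v (τ v)) →
      (∀ v, τ v = v → σ v = v) → ∀ u, σ u = u → τ u = u := by
    intro τ h1 h2 h3 u hu
    by_contra hne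
    refine absurd (hmin τ ⟨h1, h2⟩) (not_le.2 (Finset.card_lt_card ?_))
    refine Finset.ssubset_iff_subset_ne.2 ⟨fun v => by simpa using h3 v, fun h => hne ?_⟩
    have : u ∈ Finset.univ.filter fun v => σ v = v := by simpa using hu
    rw [← h] at this
    simpa using this
  have one : ∀ u u', σ u = u → σ u' = u' → ¬ G.Adj u u' := by
    intro u u' hu hu' h
    have hne := h.ne
    have := aug (fun v => if v = u then u' else if v = u' then u else σ v) (by grind)
      (by
        intro v hv
        by_cases h1 : v = u
        · subst h1; simpa using h
        · by_cases h2 : v = u'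
          · subst h2; simpa [h1] using h.symm
          · simp only [h1, h2, if_false] at hv ⊢
            exact hadj v hv)
      (by grind) u hu
    simp [hne.symm] at this
  refine ⟨σ, hσ, hadj, one, ?_⟩
  intro u u' x hu hu' hne h h'
  have hx : σ x ≠ x := fun hx => one u x hu hx h
  have n1 : u ≠ x := h.ne
  have n2 : u' ≠ σ x := h'.ne
  have n3 : u ≠ σ x := by grind
  have n4 : u' ≠ x := by grind
  -- Flip along the path `u, x, σ x, u'`: the edge `x (σ x)` is replaced by `u x` and `(σ x) u'`.
  have := aug (fun v => if v = u then x else if v = x then u else if v = u' then σ x else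
      if v = σ x then u' else σ v) (by grind)
    (by
      intro v hv
      by_cases h1 : v = u
      · subst h1; simpa using h
      by_cases h2 : v = x
      · subst h2; simpa [h1] using h.symm
      by_cases h3 : v = u'
      · subst h3; simpa [h1, h2] using h'
      by_cases h4 : v = σ x
      · subst h4; simpa [h1, h2, h3] using h'.symm
      simp only [h1, h2, h3, h4, if_false] at hv ⊢
      exact hadj v hv)
    (by grind) u hu
  simp [n1.symm] at this

/-- A graph whose minimum degree is at least a third of its order can be partitioned into paths
with two or three vertices. -/
theorem exists_partition_paths {V : Type*} [Fintype V] [DecidableEq V] (G : SimpleGraph V)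
    [DecidableRel G.Adj] {δ : ℕ} (hδ : ∀ v, δ ≤ G.degree v) (h0 : 0 < δ)
    (hcard : Fintype.card V ≤ 3 * δ) :
    ∃ B : V → Set V, (∀ v, v ∈ B v) ∧ (∀ v w, w ∈ B v → B w = B v) ∧
      ∀ v, (∃ a b, G.Adj a b ∧ B v = {a, b}) ∨
        ∃ a b c, G.Adj a b ∧ G.Adj b c ∧ a ≠ c ∧ B v = {a, b, c} := by
  obtain ⟨σ, hσ, hadj, h1, h3⟩ := G.exists_matching_without_augmentation
  have hU : (Finset.univ.filter fun v => σ v = v).card ≤ δ := by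
    set U := Finset.univ.filter fun v => σ v = v with hUdef
    by_cases hle : U.card ≤ 1
    · omega
    obtain ⟨u, hu, u', hu', hne⟩ := Finset.one_lt_card.1 (not_le.1 hle)
    rw [hUdef, Finset.mem_filter] at hu hu'
    -- Without augmenting paths, the neighbours of `u` and the partners of the neighbours of `u'`
    -- are disjoint sets of matched vertices, so `2 * δ ≤ |V| - |U| ≤ 3 * δ - |U|`.
    have hdis : Disjoint (G.neighborFinset u) ((G.neighborFinset u').image σ) := by
      rw [Finset.disjoint_left]
      intro z hz hz'
      obtain ⟨y, hy, rfl⟩ := Finset.mem_image.1 hz'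
      rw [mem_neighborFinset] at hz hy
      exact h3 u u' (σ y) hu.2 hu'.2 hne hz (by rwa [hσ])
    have hsub : G.neighborFinset u ∪ (G.neighborFinset u').image σ ⊆ Uᶜ := by
      intro z hz
      rw [Finset.mem_compl, hUdef, Finset.mem_filter]
      rintro ⟨-, hfix⟩
      rcases Finset.mem_union.1 hz with hz | hz
      · exact h1 u z hu.2 hfix ((G.mem_neighborFinset _ _).1 hz)
      · obtain ⟨y, hy, rfl⟩ := Finset.mem_image.1 hz
        rw [hσ] at hfix
        exact h1 u' y hu'.2 hfix.symm ((G.mem_neighborFinset _ _).1 hy)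
    have hc := Finset.card_le_card hsub
    have hinj : Function.Injective σ := Function.LeftInverse.injective hσ
    rw [Finset.card_union_of_disjoint hdis, Finset.card_image_of_injective _ hinj,
      card_neighborFinset_eq_degree, card_neighborFinset_eq_degree, Finset.card_compl] at hc
    have := hδ u
    have := hδ u'
    omega
  -- Hall's condition is immediate: there are at most `δ` unmatched vertices, and each has at least
  -- `δ` neighbours.
  obtain ⟨g, hg, hgadj⟩ := (Finset.all_card_le_biUnion_card_iff_exists_injective
    (fun u : {v // σ v = v} => G.neighborFinset u)).1 (by
      intro s
      rcases s.eq_empty_or_nonempty with rfl | ⟨u, hu⟩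
      · simp
      calc s.card ≤ Fintype.card {v // σ v = v} := Finset.card_le_univ s
        _ = (Finset.univ.filter fun v => σ v = v).card := Fintype.card_subtype _
        _ ≤ δ := hU
        _ ≤ (G.neighborFinset u).card := hδ u
        _ ≤ _ := Finset.card_le_card (Finset.subset_biUnion_of_mem
            (fun u : {v // σ v = v} => G.neighborFinset u) hu))
  obtain ⟨b, hbU, hbM, hbinj⟩ : ∃ b : V → V, (∀ u, σ u = u → G.Adj u (b u)) ∧
      (∀ v, σ v ≠ v → b v = v) ∧ ∀ u u', σ u = u → σ u' = u' → b u = b u' → u = u' := by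
    refine ⟨fun v => if h : σ v = v then g ⟨v, h⟩ else v, fun u hu => ?_, fun v hv => ?_, ?_⟩
    · simpa [hu] using hgadj ⟨u, hu⟩
    · simp [hv]
    · intro u u' hu hu' h
      simp only [hu, hu', dif_pos] at h
      exact congrArg Subtype.val (hg h)
  have hbne : ∀ v, σ (b v) ≠ b v := by
    intro v hv
    by_cases h : σ v = v
    · exact h1 v _ h hv (hbU v h)
    · exact h (by rwa [hbM v h] at hv)
  have key : ∀ x u, σ u = u → b u = x → {z | b z = x ∨ b z = σ x} = ({u, x, σ x} : Set V) := by
    rintro x u hu rfl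
    have hx := hbne u
    ext z
    simp only [Set.mem_ofPred_eq, Set.mem_insert_iff, Set.mem_singleton_iff]
    constructor
    · intro hz
      by_cases hzf : σ z = z
      · rcases hz with hz | hz
        · exact Or.inl (hbinj _ _ hzf hu hz)
        -- Unmatched vertices hung on opposite ends of one matching edge would form an augmenting
        -- path of length three.
        · refine absurd (hbU z hzf) (hz ▸ h3 u z (b u) hu hzf ?_ (hbU u hu))
          rintro rfl
          exact hx hz.symm
      · rw [hbM z hzf] at hz
        exact Or.inr hz
    · rintro (rfl | rfl | rfl)
      · exact Or.inl rfl
      · exact Or.inl (hbM _ hx)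
      · exact Or.inr (hbM _ (by rw [hσ]; exact hx.symm))
  -- A block is a matching edge together with the unmatched vertex, if any, hung on it.
  refine ⟨fun v => {w | b w = b v ∨ b w = σ (b v)}, fun v => Or.inl rfl, ?_, fun v => ?_⟩
  · rintro v w (h | h)
    · simp only [h]
    · simp only [h, hσ]
      ext z
      exact or_comm
  · have hx := hbne v
    by_cases hex : ∃ u, σ u = u ∧ (b u = b v ∨ b u = σ (b v))
    · right
      obtain ⟨u, hu, h | h⟩ := hex
      · exact ⟨u, b v, σ (b v), h ▸ hbU u hu, hadj _ hx, by grind, key _ u hu h⟩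
      · refine ⟨u, σ (b v), b v, h ▸ hbU u hu, (hadj _ hx).symm, by grind, ?_⟩
        have := key _ u hu h
        rw [hσ] at this
        rw [← this]
        ext z
        exact or_comm
    · left
      refine ⟨b v, σ (b v), hadj _ hx, ?_⟩
      ext z
      simp only [Set.mem_ofPred_eq, Set.mem_insert_iff, Set.mem_singleton_iff]
      constructor
      · intro hz
        by_cases hzf : σ z = z
        · exact absurd ⟨z, hzf, hz⟩ hex
        · rwa [hbM z hzf] at hz
      · rintro (rfl | rfl)
        · exact Or.inl (hbM _ hx)
        · exact Or.inr (hbM _ (by rw [hσ]; exact hx.symm))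

/-! ### Attaching the blocks -/

theorem rung_injective {r : ℕ → V₁} {k : ℕ}
    (hinj : ∀ i < 2 * (k + 1), ∀ j < 2 * (k + 1), r i = r j → i = j) {v w : V₂} {i j : ℕ}
    (hi : i < k) (hj : j < k) (h : rung r v i = rung r w j) : v = w ∧ i = j := by
  rcases Sym2.eq_iff.1 h with ⟨h, -⟩ | ⟨h, -⟩
  · have := hinj _ (by omega) _ (by omega) (congrArg Prod.fst h)
    exact ⟨congrArg Prod.snd h, by omega⟩
  · have := hinj _ (by omega) _ (by omega) (congrArg Prod.fst h)
    omega

/-- Merging two rung cycles along the rung number `t` over an edge `s(u, w)`. -/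
theorem HasRungCycle.merge [DecidableEq V₂] {r : ℕ → V₁} {k : ℕ}
    (hinj : ∀ i < 2 * (k + 1), ∀ j < 2 * (k + 1), r i = r j → i = j) {S B : Set V₂}
    [DecidablePred (· ∈ S)] {A A' : V₂ → Finset ℕ} (hS : HasRungCycle G₁ G₂ r S A)
    (hB : HasRungCycle G₁ G₂ r B A') (hA : ∀ v ∈ S, A v ⊆ Finset.range k)
    (hA' : ∀ v ∈ B, A' v ⊆ Finset.range k) (hdis : ∀ v ∈ S, v ∉ B) {u w : V₂} (hu : u ∈ S)
    (hw : w ∈ B) (huw : G₂.Adj u w) {t : ℕ} (htu : t ∈ A u) (htw : t ∈ A' w) :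
    HasRungCycle G₁ G₂ r (S ∪ B) (fun v => if v ∈ S then (if v = u then (A v).erase t else A v)
      else (if v = w then (A' v).erase t else A' v)) := by
  have htk : t < k := Finset.mem_range.1 (hA u hu htu)
  refine (HasCycleOn.merge hS hB (fun v => hdis v.2)
    (a := (r (2 * t + 1), u)) (a' := (r (2 * t + 2), u))
    (b := (r (2 * t + 1), w)) (b' := (r (2 * t + 2), w))
    ⟨u, hu, t, htu, rfl⟩ ⟨w, hw, t, htw, rfl⟩ (boxProd_adj.2 (Or.inr ⟨huw, rfl⟩))
    (boxProd_adj.2 (Or.inr ⟨huw, rfl⟩))).mono (fun v => Iff.rfl) ?_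
  rintro e ⟨v, hv, i, hi, rfl⟩
  beta_reduce at hi
  by_cases hvS : v ∈ S
  · rw [if_pos hvS] at hi
    have hiA : i ∈ A v := by
      split_ifs at hi with h
      · exact Finset.mem_of_mem_erase hi
      · exact hi
    refine Or.inl (Or.inr ⟨⟨v, hvS, i, hiA, rfl⟩, fun h => ?_⟩)
    obtain ⟨rfl, rfl⟩ := rung_injective hinj (Finset.mem_range.1 (hA v hvS hiA)) htk h
    simp at hi
  · rw [if_neg hvS] at hi
    have hvB : v ∈ B := hv.resolve_left hvS
    have hiA : i ∈ A' v := by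
      split_ifs at hi with h
      · exact Finset.mem_of_mem_erase hi
      · exact hi
    refine Or.inr ⟨⟨v, hvB, i, hiA, rfl⟩, fun h => ?_⟩
    obtain ⟨rfl, rfl⟩ := rung_injective hinj (Finset.mem_range.1 (hA' v hvB hiA)) htk h
    simp at hi

/-- If a connected graph is partitioned into attachable blocks, then these can be attached one
after the other. -/
theorem exists_hasRungCycle_univ [Fintype V₂] [DecidableEq V₂] [DecidableRel G₂.Adj]
    (hconn : G₂.Connected) {r : ℕ → V₁} {k d : ℕ}
    (hinj : ∀ i < 2 * (k + 1), ∀ j < 2 * (k + 1), r i = r j → i = j)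
    (hdeg : ∀ v, G₂.degree v ≤ d + 1) (B : V₂ → Set V₂) (hself : ∀ v, v ∈ B v)
    (hpart : ∀ v w, w ∈ B v → B w = B v) (hnb : ∀ v, ∃ y ∈ B v, G₂.Adj v y)
    (hatt : ∀ v, IsAttachable G₁ G₂ r k d (B v)) :
    ∃ A, HasRungCycle G₁ G₂ r (Set.univ : Set V₂) A := by
  classical
  have hout : ∀ v (S : Finset V₂), B v ⊆ S → (G₂.neighborFinset v \ S).card ≤ d := by
    intro v S hS
    obtain ⟨y, hy, hvy⟩ := hnb v
    have hlt : (G₂.neighborFinset v \ S).card < (G₂.neighborFinset v).card := by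
      refine Finset.card_lt_card (Finset.ssubset_iff_subset_ne.2 ⟨Finset.sdiff_subset, fun h => ?_⟩)
      have := (G₂.mem_neighborFinset _ _).2 hvy
      rw [← h] at this
      exact (Finset.mem_sdiff.1 this).2 (hS hy)
    have := hdeg v
    rw [card_neighborFinset_eq_degree] at hlt
    omega
  -- The invariant: `S` is a union of blocks, and each vertex keeps a rung for every neighbour
  -- outside `S`. A largest such `S` is shown to be everything.
  let P : Finset V₂ → Prop := fun S => S.Nonempty ∧ (∀ v ∈ S, B v ⊆ S) ∧ ∃ A : V₂ → Finset ℕ,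
    (∀ v ∈ S, A v ⊆ Finset.range k ∧ (G₂.neighborFinset v \ S).card ≤ (A v).card) ∧
    HasRungCycle G₁ G₂ r (S : Set V₂) A
  have hne : ({S | P S} : Set (Finset V₂)).Nonempty := by
    obtain ⟨v⟩ := hconn.nonempty
    obtain ⟨A, -, hA, hcyc⟩ := hatt v v (hself v) 0
    have hco : ((B v).toFinset : Set V₂) = B v := Set.coe_toFinset _
    refine ⟨(B v).toFinset, ⟨v, by simpa using hself v⟩, ?_, A, ?_, by rwa [hco]⟩
    · intro x hx
      rw [hco, hpart v x (Set.mem_toFinset.1 hx)]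
    · intro x hx
      have hx' := Set.mem_toFinset.1 hx
      exact ⟨(hA x hx').1, (hout x _ (by rw [hco, hpart v x hx'])).trans (hA x hx').2⟩
  obtain ⟨S, ⟨⟨v₀, hv₀⟩, hclosed, A, hA, hcyc⟩, hmax⟩ :=
    Set.exists_max_image _ Finset.card (Set.toFinite _) hne
  by_cases huniv : (S : Set V₂) = Set.univ
  · exact ⟨A, huniv ▸ hcyc⟩
  exfalso
  obtain ⟨z, hz⟩ := (Set.ne_univ_iff_exists_notMem _).1 huniv
  obtain ⟨p⟩ := hconn.preconnected v₀ z
  obtain ⟨⟨⟨u, w⟩, huw⟩, -, hu, hw⟩ := p.exists_boundary_dart S hv₀ hz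
  simp only [Finset.mem_coe] at hu hw huw
  have hdis : ∀ v ∈ (S : Set V₂), v ∉ B w := fun v hv hvw =>
    hw (hclosed v hv (hpart w v hvw ▸ hself w))
  have hwmem : w ∈ G₂.neighborFinset u \ S :=
    Finset.mem_sdiff.2 ⟨(G₂.mem_neighborFinset _ _).2 huw, hw⟩
  obtain ⟨t, ht⟩ : (A u).Nonempty :=
    Finset.card_pos.1 ((Finset.card_pos.2 ⟨w, hwmem⟩).trans_le (hA u hu).2)
  obtain ⟨A', htA', hA', hcyc'⟩ := hatt w w (hself w) t
  have htw := htA' (Finset.mem_range.1 ((hA u hu).1 ht))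
  have hcyc2 := hcyc.merge hinj hcyc' (fun v hv => (hA v hv).1) (fun v hv => (hA' v hv).1) hdis hu
    (hself w) huw ht htw
  have hco : ((S ∪ (B w).toFinset : Finset V₂) : Set V₂) = ↑S ∪ B w := by simp
  have hPnew : P (S ∪ (B w).toFinset) := by
    refine ⟨⟨u, Finset.mem_union_left _ hu⟩, fun v hv => ?_, _, fun v hv => ?_, hco ▸ hcyc2⟩
    · rw [hco]
      rcases Finset.mem_union.1 hv with hv | hv
      · exact (hclosed v hv).trans Set.subset_union_left
      · rw [hpart w v (Set.mem_toFinset.1 hv)]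
        exact Set.subset_union_right
    · have hmono : G₂.neighborFinset v \ (S ∪ (B w).toFinset) ⊆ G₂.neighborFinset v \ S :=
        Finset.sdiff_subset_sdiff subset_rfl Finset.subset_union_left
      by_cases hvS : v ∈ S
      · simp only [Finset.mem_coe, hvS, if_true]
        obtain ⟨h1, h2⟩ := hA v hvS
        split_ifs with hvu
        -- The old endpoint loses rung `t`, but also the outside neighbour `w`.
        · subst hvu
          refine ⟨(Finset.erase_subset _ _).trans h1, ?_⟩
          rw [Finset.card_erase_of_mem ht]
          have : (G₂.neighborFinset v \ (S ∪ (B w).toFinset)).card <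
              (G₂.neighborFinset v \ S).card := by
            refine Finset.card_lt_card (Finset.ssubset_iff_subset_ne.2 ⟨hmono, fun h => ?_⟩)
            rw [← h] at hwmem
            exact (Finset.mem_sdiff.1 hwmem).2
              (Finset.mem_union_right _ (Set.mem_toFinset.2 (hself w)))
          omega
        · exact ⟨h1, (Finset.card_le_card hmono).trans h2⟩
      · have hvB : v ∈ B w := Set.mem_toFinset.1 ((Finset.mem_union.1 hv).resolve_left hvS)
        simp only [Finset.mem_coe, hvS, if_false]
        obtain ⟨h1, h2⟩ := hA' v hvB
        have hBv : B v = B w := hpart w v hvB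
        split_ifs with hvw
        -- The new endpoint loses rung `t`, but its neighbour `u` lies in `S`, so fewer than `d`
        -- neighbours remain outside.
        · subst hvw
          refine ⟨(Finset.erase_subset _ _).trans h1, ?_⟩
          rw [Finset.card_erase_of_mem htw]
          have hlt : (G₂.neighborFinset v \ (S ∪ (B v).toFinset)).card <
              (G₂.neighborFinset v \ (B v).toFinset).card := by
            refine Finset.card_lt_card (Finset.ssubset_iff_subset_ne.2
              ⟨Finset.sdiff_subset_sdiff subset_rfl Finset.subset_union_right, fun h => ?_⟩)
            have : u ∈ G₂.neighborFinset v \ (B v).toFinset :=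
              Finset.mem_sdiff.2 ⟨(G₂.mem_neighborFinset _ _).2 huw.symm,
                fun h => hdis u hu (Set.mem_toFinset.1 h)⟩
            rw [← h] at this
            exact (Finset.mem_sdiff.1 this).2 (Finset.mem_union_left _ hu)
          have := hout v (B v).toFinset (by simp)
          omega
        · exact ⟨h1, (hout v _ (by rw [hco, hBv]; exact Set.subset_union_right)).trans h2⟩
  have hcard := hmax _ hPnew
  refine absurd hcard (not_le.2 (Finset.card_lt_card (Finset.ssubset_iff_subset_ne.2
    ⟨Finset.subset_union_left, fun h => hw ?_⟩)))
  rw [h]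
  exact Finset.mem_union_right _ (Set.mem_toFinset.2 (hself w))

end SimpleGraph

/-! ### The main theorem -/

theorem mainTheorem8 {V₁ : Type*} {V₂ : Type*} [Fintype V₁] [DecidableEq V₁]
    [Fintype V₂] [DecidableEq V₂]
    (G₁ : SimpleGraph V₁) (G₂ : SimpleGraph V₂) [DecidableRel G₂.Adj]
    (hconn : G₂.Connected)
    (hmin : (Fintype.card V₂ : ℚ) / 3 ≤ (G₂.minDegree : ℚ))
    (htrace : G₁.IsTraceable)
    (heven : Even (Fintype.card V₁))
    (hcard : 4 * (G₂.maxDegree : ℤ) - 2 ≤ (Fintype.card V₁ : ℤ)) :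
    ∃ (x : V₁ × V₂) (c : (SimpleGraph.boxProd G₁ G₂).Walk x x), c.IsHamiltonianCycle := by
  obtain ⟨a, b, p, hp⟩ := htrace
  have hlen := hp.length_support
  rw [SimpleGraph.Walk.length_support] at hlen
  have hmin' : Fintype.card V₂ ≤ 3 * G₂.minDegree := by
    rw [div_le_iff₀ (by norm_num)] at hmin
    have : (Fintype.card V₂ : ℚ) ≤ ((3 * G₂.minDegree : ℕ) : ℚ) := by push_cast; linarith
    exact_mod_cast this
  have := hconn.nonempty
  have hV₂ : 0 < Fintype.card V₂ := Fintype.card_pos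
  have hδ : ∀ v, G₂.minDegree ≤ G₂.degree v := G₂.minDegree_le_degree
  have hΔ : ∀ v, G₂.degree v ≤ G₂.maxDegree := G₂.degree_le_maxDegree
  obtain ⟨v₀⟩ := this
  have hΔ0 : 0 < G₂.maxDegree := by have := hδ v₀; have := hΔ v₀; omega
  obtain ⟨k, hk⟩ : ∃ k, Fintype.card V₁ = 2 * (k + 1) := by
    obtain ⟨m, hm⟩ := heven
    exact ⟨m - 1, by omega⟩
  have hinj : ∀ i < 2 * (k + 1), ∀ j < 2 * (k + 1), p.getVert i = p.getVert j → i = j :=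
    fun i hi j hj h => hp.isPath.getVert_injOn (by omega : i ≤ p.length)
      (by omega : j ≤ p.length) h
  have hadj : ∀ i, i + 1 < 2 * (k + 1) → G₁.Adj (p.getVert i) (p.getVert (i + 1)) :=
    fun i hi => p.adj_getVert_succ (by omega)
  have hsurj : ∀ v, ∃ i < 2 * (k + 1), p.getVert i = v := by
    intro v
    obtain ⟨i, h, hi⟩ := SimpleGraph.Walk.mem_support_iff_exists_getVert.1 (hp.mem_support v)
    exact ⟨i, by omega, h⟩
  obtain ⟨B, hself, hpart, hB⟩ := G₂.exists_partition_paths hδ (by omega) hmin'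
  obtain ⟨A, x, c, hc, hcs, -⟩ := SimpleGraph.exists_hasRungCycle_univ (G₁ := G₁) (k := k)
    (d := G₂.maxDegree - 1) hconn hinj (fun v => by have := hΔ v; omega) B hself hpart
    (by
      intro v
      have hv := hself v
      rcases hB v with ⟨a, b, hab, h⟩ | ⟨a, b, c, hab, hbc, -, h⟩ <;> rw [h] at hv ⊢
      · rcases hv with rfl | rfl
        · exact ⟨b, by simp, hab⟩
        · exact ⟨a, by simp, hab.symm⟩
      · rcases hv with rfl | rfl | rfl
        · exact ⟨b, by simp, hab⟩
        · exact ⟨a, by simp, hab.symm⟩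
        · exact ⟨b, by simp, hbc.symm⟩)
    (by
      intro v
      rcases hB v with ⟨a, b, hab, h⟩ | ⟨a, b, c, hab, hbc, hac, h⟩ <;> rw [h]
      · exact SimpleGraph.isAttachable_pair hinj hadj hsurj (by omega) hab
      -- A three-vertex block forces `Δ ≥ 2`, hence `d = Δ - 1 ≥ 1`.
      · have h2 : 1 < G₂.degree b := by
          rw [← SimpleGraph.card_neighborFinset_eq_degree, Finset.one_lt_card]
          exact ⟨a, by simpa using hab.symm, c, by simpa using hbc, hac⟩
        have := hΔ b
        exact SimpleGraph.isAttachable_triple hinj hadj hsurj (by omega) (by omega) hab hbc hac)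
  refine ⟨x, c, SimpleGraph.Walk.isHamiltonianCycle_isCycle_and_isHamiltonian_tail.2
    ⟨hc, hc.isPath_tail.isHamiltonian_of_mem fun v => ?_⟩⟩
  rw [SimpleGraph.Walk.support_tail_of_not_nil _ hc.not_nil]
  have hv : v ∈ c.support := (hcs v).2 (Set.mem_univ v.2)
  rw [← SimpleGraph.Walk.cons_tail_support, List.mem_cons] at hv
  rcases hv with rfl | hv
  · exact SimpleGraph.Walk.end_mem_tail_support hc.not_nil
  · exact hv
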